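/- Let $K$ be a number field with ring of integers $\mathcal O_K$, let $S=\operatorname{Spec}\mathcal O_K$, let $\pi:\mathcal X\to S$ be a flat quasi-projective integral scheme with smooth generic fibre $\mathcal X_K$, and let $\mathcal L$ be a line bundle on $\mathcal X$. Let $\mathcal F\subset\mathcal F'\subset\pi_*\mathcal L$ be vector bundles over $S$ (that is, finitely generated $\mathcal O_K$-submodules of $H^0(\mathcal X,\mathcal L)$), and assume that $\mathcal L_K$ is generated over $\mathcal X_K$ by its sections in $\mathcal F_K=\mathcal F\otimes_{\mathcal O_K}K\subset H^0(\mathcal X_K,\mathcal L_K)$. For $\mathcal G\in\{\mathcal F,\mathcal F'\}$, let $\mathcal B_{\mathcal G}\subset\mathcal X$ be the closed subscheme of base points of $\mathcal G$: its ideal sheaf $I_{\mathcal B_{\mathcal G}}$ is the one for which the image of the canonical map $\pi^*\mathcal G\to\mathcal L$ is $I_{\mathcal B_{\mathcal G}}\cdot\mathcal L$. For a section $P:S\to\mathcal X$ of $\pi$, the closed subscheme $P^*\mathcal B_{\mathcal G}$ of $S$ is an effective divisor (its ideal is nonzero), and the integers $\beta_{\mathfrak p}(\mathcal L,\mathcal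 G,P)$, almost all zero, are defined by $$P^*\mathcal B_{\mathcal G}=\sum_{\mathfrak p}\beta_{\mathfrak p}(\mathcal L,\mathcal G,P)\,\mathfrak p ,$$ where $\mathfrak p$ runs over the nonzero prime ideals of $\mathcal O_K$. Then, for every section $P$ of $\pi$ and every nonzero prime $\mathfrak p$ of $\mathcal O_K$, $$0\le\beta_{\mathfrak p}(\mathcal L,\mathcal F',P)\le\beta_{\mathfrak p}(\mathcal L,\mathcal F,P).$$ If moreover $\mathcal F_K=\mathcal F'_K$, then $\mathcal F'/\mathcal F$ is finite and $$\sum_{\mathfrak p}\beta_{\mathfrak p}(\mathcal L,\mathcal F,P)\log N\mathfrak p-\sum_{\mathfrak p}\beta_{\mathfrak p}(\mathcal L,\mathcal F',P)\log N\mathfrak p\le\log\#(\mathcal F'/\mathcal F),$$ where $N\mathfrak p=\#(\mathcal O_K/\mathfrak p)$. -/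

import Mathlib

open CategoryTheory AlgebraicGeometry NumberField IsDedekindDomain
open scoped nonZeroDivisors

universe u

noncomputable section

namespace BasePoints

/-- `L` is a line bundle: every point has an open neighbourhood `U` with `L|_U ≅ 𝒪_U`. -/
def IsLineBundle {X : Scheme.{u}} (L : X.Modules) : Prop :=
  ∀ x : X, ∃ U : X.Opens, x ∈ U ∧
    Nonempty (L.restrict U.ι ≅ (SheafOfModules.unit (U : Scheme.{u}).ringCatSheaf :
      (U : Scheme.{u}).Modules))

attribute [local instance] MvPolynomial.gradedAlgebra

/-- Projective space `ℙⁿ` over `R`, as `Proj` of the polynomial ring in `n + 1` variables. -/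
abbrev projSpace (n : ℕ) (R : Type u) [CommRing R] : Scheme.{u} :=
  Proj (MvPolynomial.homogeneousSubmodule (Fin (n + 1)) R)

/-- The structure morphism `ℙⁿ_R ⟶ Spec R`. -/
def projSpaceToSpec (n : ℕ) (R : Type u) [CommRing R] :
    projSpace n R ⟶ Spec (CommRingCat.of R) :=
  Proj.toSpecZero (MvPolynomial.homogeneousSubmodule (Fin (n + 1)) R) ≫
    Spec.map (CommRingCat.ofHom
      (algebraMap R (MvPolynomial.homogeneousSubmodule (Fin (n + 1)) R 0)))

/-- A scheme over an affine base is quasi-projective if it is, over the base, a locally closed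
subscheme of some projective space. -/
def IsQuasiProjective {R : Type u} [CommRing R] {X : Scheme.{u}}
    (π : X ⟶ Spec (CommRingCat.of R)) : Prop :=
  ∃ (n : ℕ) (i : X ⟶ projSpace n R), IsImmersion i ∧ i ≫ projSpaceToSpec n R = π

variable {K : Type u} [Field K] [NumberField K] {X : Scheme.{u}}

/-- The generic fibre `X_K ⟶ Spec K` of `π : X ⟶ Spec 𝓞_K`. -/
def genericFibre (π : X ⟶ Spec (CommRingCat.of (𝓞 K))) :
    Limits.pullback π (Spec.map (CommRingCat.ofHom (algebraMap (𝓞 K) K))) ⟶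
      Spec (CommRingCat.of K) :=
  Limits.pullback.snd _ _

/-- The `𝓞_K`-module of global sections of `π_* L` (that is, of `L`). -/
abbrev pushSections (π : X ⟶ Spec (CommRingCat.of (𝓞 K))) (L : X.Modules) : Type u :=
  Γ((Scheme.Modules.pushforward π).obj L, ⊤)

instance (π : X ⟶ Spec (CommRingCat.of (𝓞 K))) (L : X.Modules) :
    Module (𝓞 K) (pushSections π L) :=
  Module.compHom Γ((Scheme.Modules.pushforward π).obj L, ⊤)
    (Scheme.ΓSpecIso (CommRingCat.of (𝓞 K))).inv.hom

/-- The restriction to an open `U ⊆ X` of a global section of `π_* L`. -/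
def resSection (π : X ⟶ Spec (CommRingCat.of (𝓞 K))) (L : X.Modules) (U : X.Opens)
    (s : pushSections π L) : Γ(L, U) :=
  L.presheaf.map (homOfLE (le_top : U ≤ (⊤ : X.Opens))).op s

/-- The `𝒪_X(U)`-submodule of `L(U)` generated by (the restrictions of) the elements of `F`. For
`U` affine these are the sections over `U` of the image of `π^* F ⟶ L`. -/
def generatedSections (π : X ⟶ Spec (CommRingCat.of (𝓞 K))) (L : X.Modules)
    (F : Submodule (𝓞 K) (pushSections π L)) (U : X.Opens) : Submodule Γ(X, U) Γ(L, U) :=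
  Submodule.span Γ(X, U) (resSection π L U '' (F : Set (pushSections π L)))

/-- `L_K` is generated over `X_K` by `F_K`: the map `π^* F ⟶ L` is surjective on stalks at all
points of `X` lying over the generic point of `Spec 𝓞_K`. -/
def GeneratesGenerically (π : X ⟶ Spec (CommRingCat.of (𝓞 K))) (L : X.Modules)
    (F : Submodule (𝓞 K) (pushSections π L)) : Prop :=
  ∀ x : X, π x = (⊥ : PrimeSpectrum (𝓞 K)) →
    ∀ (U : X.Opens), x ∈ U → ∀ t : Γ(L, U),
      ∃ (V : X.Opens) (i : V ≤ U), x ∈ V ∧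
        L.presheaf.map (homOfLE i).op t ∈ generatedSections π L F V

/-- The ideal sheaf `I` of the base-point subscheme of `F`, characterised by `I · L` being the
image of `π^* F ⟶ L`; as `L` is invertible, it is the largest ideal sheaf `I` such that `I · L` is
contained in that image. -/
def baseIdeal (π : X ⟶ Spec (CommRingCat.of (𝓞 K))) (L : X.Modules)
    (F : Submodule (𝓞 K) (pushSections π L)) : X.IdealSheafData :=
  sSup {I | ∀ U : X.affineOpens,
    I.ideal U • (⊤ : Submodule Γ(X, U) Γ(L, U)) ≤ generatedSections π L F U}

/-- The ideal of `𝓞_K` defining the closed subscheme `P^* B_F` of `Spec 𝓞_K`, for a morphism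
`P : Spec 𝓞_K ⟶ X`. -/
def pullbackIdeal (π : X ⟶ Spec (CommRingCat.of (𝓞 K))) (L : X.Modules)
    (F : Submodule (𝓞 K) (pushSections π L)) (P : Spec (CommRingCat.of (𝓞 K)) ⟶ X) :
    Ideal (𝓞 K) :=
  (((baseIdeal π L F).comap P).ideal ⟨⊤, isAffineOpen_top _⟩).comap
    (Scheme.ΓSpecIso (CommRingCat.of (𝓞 K))).inv.hom

/-- The multiplicity of `P^* B_F` at the finite prime `𝔭`: the exponent of `𝔭` in the prime
factorisation of its ideal. -/
def beta (π : X ⟶ Spec (CommRingCat.of (𝓞 K))) (L : X.Modules)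
    (F : Submodule (𝓞 K) (pushSections π L)) (P : Spec (CommRingCat.of (𝓞 K)) ⟶ X)
    (𝔭 : HeightOneSpectrum (𝓞 K)) : ℤ :=
  FractionalIdeal.count K 𝔭 (pullbackIdeal π L F P : FractionalIdeal (𝓞 K)⁰ K)

end BasePoints

end

/-! Fix a frame of `L` around the image under `P` of the generic point. Evaluating global sections
along `P` in this frame gives an `𝓞 K`-linear map `φ` to `K`, so `φ(F) ⊆ φ(F')` are fractional
ideals, nonzero because `F` generates `L` generically. Near a prime `𝔭`, the ideal of `P^* B_F`
consists of the values of `F` in a frame around `P 𝔭`. Changing to the fixed frame multiplies values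
by a scalar of `K` independent of `F`, so `β_𝔭(F) = c_𝔭 + v_𝔭(φ(F))` with the same `c_𝔭` for `F` and
`F'` (`count_pullbackIdeal`).

Monotonicity of `v_𝔭` gives the inequality, and nonnegativity holds since the pulled-back ideal is
integral. In the difference of the two sums the `c_𝔭` cancel, leaving the log of the index of `φ(F)`
in `φ(F')`. This index is at most `#(F'/F)`, because `φ` induces a surjection from `F'/F` onto
`φ(F')/φ(F)` (`absNorm_le_mul_card`).

The geometric work is to compute `baseIdeal`, defined as a supremum, on affine opens with a frame
(`IsFrame.baseIdeal_ideal`), and to follow it through `P` (`ideal_comap_of_le`,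
`IsFrame.exists_pow_smul_eval`). -/

namespace BasePoints
-- Local frames of a line bundle
variable {X : Scheme.{u}}

/-- `e` freely generates `L` over `V`. -/
def IsFrame (L : X.Modules) (V : X.Opens) (e : Γ(L, V)) : Prop :=
  ∀ (W : X.Opens) (i : W ≤ V),
    Function.Bijective fun a : Γ(X, W) ↦ a • L.presheaf.map (homOfLE i).op e

lemma map_map (L : X.Modules) {U V W : X.Opens} (i : W ≤ V) (j : V ≤ U) (s : Γ(L, U)) :
    L.presheaf.map (homOfLE i).op (L.presheaf.map (homOfLE j).op s) =
      L.presheaf.map (homOfLE (i.trans j)).op s := by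
  rw [← ConcreteCategory.comp_apply, ← L.presheaf.map_comp]; rfl

lemma ring_map_map {U V W : X.Opens} (i : W ≤ V) (j : V ≤ U) (s : Γ(X, U)) :
    X.presheaf.map (homOfLE i).op (X.presheaf.map (homOfLE j).op s) =
      X.presheaf.map (homOfLE (i.trans j)).op s := by
  rw [← ConcreteCategory.comp_apply, ← X.presheaf.map_comp]; rfl

lemma IsFrame.restrict {L : X.Modules} {V : X.Opens} {e : Γ(L, V)} (he : IsFrame L V e)
    {W : X.Opens} (i : W ≤ V) : IsFrame L W (L.presheaf.map (homOfLE i).op e) := by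
  intro W' i'
  simpa only [map_map] using he W' (i'.trans i)

lemma IsLineBundle.exists_isFrame {L : X.Modules} (hL : IsLineBundle L) (x : X) :
    ∃ (U : X.Opens) (e : Γ(L, U)), x ∈ U ∧ IsFrame L U e := by
  obtain ⟨U, hxU, ⟨φ⟩⟩ := hL x
  let o : Γ((SheafOfModules.unit (U : Scheme.{u}).ringCatSheaf :
      (U : Scheme.{u}).Modules), ⊤) := (1 : Γ((U : Scheme.{u}), ⊤))
  let e : Γ(L.restrict U.ι, ⊤) := φ.inv.app ⊤ o
  have key : ∀ W : (U : Scheme.{u}).Opens,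
      Function.Bijective fun a : Γ((U : Scheme.{u}), W) ↦
        a • (L.restrict U.ι).presheaf.map (homOfLE (le_top : W ≤ ⊤)).op e := by
    intro W
    have hmap : ∀ a : Γ((U : Scheme.{u}), W),
        a • (L.restrict U.ι).presheaf.map (homOfLE (le_top : W ≤ ⊤)).op e = φ.inv.app W a := by
      intro a
      have h1 : (L.restrict U.ι).presheaf.map (homOfLE (le_top : W ≤ ⊤)).op e =
          φ.inv.app W (1 : Γ((U : Scheme.{u}), W)) := by
        have := congr($(φ.inv.mapPresheaf.naturality (homOfLE (le_top : W ≤ ⊤)).op) o)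
        refine Eq.trans this.symm ?_
        change φ.inv.app W ((U : Scheme.{u}).presheaf.map _ (1 : Γ((U : Scheme.{u}), ⊤))) = _
        rw [map_one]
      rw [h1]
      refine (Scheme.Modules.Hom.app_smul φ.inv a _).symm.trans ?_
      congr 1
      exact mul_one (M := Γ((U : Scheme.{u}), W)) a
    have h1 : ∀ y, φ.inv.app W (φ.hom.app W y) = y := fun y ↦ congr($(φ.hom_inv_id).app W y)
    have h2 : ∀ y, φ.hom.app W (φ.inv.app W y) = y := fun y ↦ congr($(φ.inv_hom_id).app W y)
    refine ⟨fun a b hab ↦ ?_, fun y ↦ ⟨φ.hom.app W y, (hmap _).trans (h1 y)⟩⟩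
    rw [← h2 a, ← h2 b]
    exact congrArg _ ((hmap a).symm.trans (hab.trans (hmap b)))
  have hU : U ≤ U.ι ''ᵁ ⊤ := by simp
  let e' : Γ(L, U.ι ''ᵁ ⊤) := e
  refine ⟨U, L.presheaf.map (homOfLE hU).op e', hxU, fun W i ↦ ?_⟩
  obtain ⟨W', rfl⟩ : ∃ W' : (U : Scheme.{u}).Opens, U.ι ''ᵁ W' = W :=
    ⟨U.ι ⁻¹ᵁ W, by simpa [Scheme.Hom.image_preimage_eq_opensRange_inf] using i⟩
  simp only [map_map]
  refine (congrArg Function.Bijective (funext fun a : Γ(X, U.ι ''ᵁ W') ↦ ?_)).mp (key W')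
  -- Scalars act on the restricted module through `appIso`, which is trivial for the inclusion of an
  -- open.
  change (U.ι.appIso W').inv a • L.presheaf.map
    (homOfLE (Scheme.Hom.image_mono U.ι (le_top : W' ≤ ⊤))).op e' = _
  rw [Scheme.Opens.ι_appIso]
  rfl

lemma eq_of_locally_eq (L : X.Modules) {U : X.Opens} (s t : Γ(L, U))
    (h : ∀ x ∈ U, ∃ (V : X.Opens) (i : V ≤ U), x ∈ V ∧
      L.presheaf.map (homOfLE i).op s = L.presheaf.map (homOfLE i).op t) : s = t := by
  choose V i hx h using h
  refine TopCat.Sheaf.eq_of_locally_eq' ⟨L.presheaf, L.isSheaf⟩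
    (fun x : U ↦ V x.1 x.2) U (fun x ↦ homOfLE (i x.1 x.2)) (fun x hxU ↦ ?_) s t
    fun x ↦ h x.1 x.2
  exact TopologicalSpace.Opens.mem_iSup.mpr ⟨⟨x, hxU⟩, hx x hxU⟩

lemma map_smul_section {L : X.Modules} {V W : X.Opens} (e : Γ(L, V)) (i : W ≤ V) (a : Γ(X, V)) :
    L.presheaf.map (homOfLE i).op (a • e) =
      X.presheaf.map (homOfLE i).op a • L.presheaf.map (homOfLE i).op e :=
  L.map_smul _ _ _

lemma IsFrame.exists_eq_smul {L : X.Modules} {V : X.Opens} {e : Γ(L, V)} (he : IsFrame L V e)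
    (s : Γ(L, V)) : ∃ a : Γ(X, V), a • e = s := by
  obtain ⟨a, ha⟩ := (he V le_rfl).2 s
  refine ⟨a, ?_⟩
  rw [← ha]
  have : (homOfLE (le_refl V)).op = 𝟙 _ := rfl
  simp

lemma IsFrame.smul_injective {L : X.Modules} {V : X.Opens} {e : Γ(L, V)} (he : IsFrame L V e) :
    Function.Injective fun a : Γ(X, V) ↦ a • e := by
  intro a b hab
  apply (he V le_rfl).1
  have : (homOfLE (le_refl V)).op = 𝟙 _ := rfl
  simpa [this] using hab

lemma exists_affine_isFrame {L : X.Modules} (hL : IsLineBundle L) {U : X.Opens} {x : X}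
    (hx : x ∈ U) : ∃ (V : X.affineOpens) (e : Γ(L, V)), x ∈ V.1 ∧ V.1 ≤ U ∧ IsFrame L V e := by
  obtain ⟨W, e, hxW, he⟩ := hL.exists_isFrame x
  obtain ⟨_, ⟨V, hV, rfl⟩, hxV, hVU⟩ :=
    X.isBasis_affineOpens.exists_subset_of_mem_open (show x ∈ (W ⊓ U : X.Opens) from ⟨hxW, hx⟩)
      (W ⊓ U).isOpen
  have h : V ≤ W ⊓ U := hVU
  exact ⟨⟨V, hV⟩, _, hxV, h.trans inf_le_right, he.restrict (h.trans inf_le_left)⟩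

lemma ring_map_injective [IsIntegral X] {U V : X.Opens} (i : V ≤ U) (hV : (V : Set X).Nonempty) :
    Function.Injective (X.presheaf.map (homOfLE i).op) := by
  have : Nonempty V := hV.to_subtype
  exact map_injective_of_isIntegral X (homOfLE i)

/-- In a frame this becomes injectivity of restriction for functions on an integral scheme.
Irreducibility makes `V ⊓ W` nonempty for every frame open `V` around a point of `U`. -/
lemma IsLineBundle.map_injective [IsIntegral X] {L : X.Modules} (hL : IsLineBundle L)
    {U W : X.Opens} (i : W ≤ U) (hW : (W : Set X).Nonempty) :
    Function.Injective (L.presheaf.map (homOfLE i).op) := by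
  intro s t hst
  refine eq_of_locally_eq L s t fun x hx ↦ ?_
  obtain ⟨V, e, hxV, hVU, he⟩ := exists_affine_isFrame hL hx
  refine ⟨V, hVU, hxV, ?_⟩
  obtain ⟨a, ha⟩ := he.exists_eq_smul (L.presheaf.map (homOfLE hVU).op s)
  obtain ⟨b, hb⟩ := he.exists_eq_smul (L.presheaf.map (homOfLE hVU).op t)
  rw [← ha, ← hb]
  congr 1
  have hne : ((V.1 ⊓ W : X.Opens) : Set X).Nonempty :=
    nonempty_preirreducible_inter V.1.isOpen W.isOpen ⟨x, hxV⟩ hW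
  refine ring_map_injective (inf_le_left : V.1 ⊓ W ≤ V.1) hne
    ((he.restrict inf_le_left).smul_injective ?_)
  simp only [← map_smul_section, ha, hb, map_map]
  rw [← map_map L (inf_le_right : V.1 ⊓ W ≤ W) i, hst, map_map]

end BasePoints

/-! ### The base-point ideal sheaf on opens with a frame -/

namespace BasePoints

section BaseIdeal

variable {K : Type u} [Field K] {X : Scheme.{u}}
  {π : X ⟶ Spec (CommRingCat.of (𝓞 K))} {L : X.Modules}
  {F : Submodule (𝓞 K) (pushSections π L)}

lemma map_resSection {U V : X.Opens} (i : V ≤ U) (s : pushSections π L) :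
    L.presheaf.map (homOfLE i).op (resSection π L U s) = resSection π L V s :=
  map_map L i le_top _

lemma map_mem_generatedSections {U V : X.Opens} (i : V ≤ U) {y : Γ(L, U)}
    (hy : y ∈ generatedSections π L F U) :
    L.presheaf.map (homOfLE i).op y ∈ generatedSections π L F V := by
  induction hy using Submodule.span_induction with
  | mem y hy =>
    obtain ⟨s, hs, rfl⟩ := hy
    rw [map_resSection]
    exact Submodule.subset_span ⟨s, hs, rfl⟩
  | zero => simp
  | add y z _ _ hy hz => rw [map_add]; exact add_mem hy hz
  | smul a y _ hy => rw [map_smul_section]; exact Submodule.smul_mem _ _ hy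

/-- Generators over `D(r)` are restrictions of global sections, so only the coefficients have
denominators, and these are powers of `r`. -/
lemma exists_pow_smul_eq_map {U : X.Opens} (hU : IsAffineOpen U) (r : Γ(X, U))
    {z : Γ(L, X.basicOpen r)} (hz : z ∈ generatedSections π L F (X.basicOpen r)) :
    ∃ n : ℕ, ∃ w ∈ generatedSections π L F U, L.presheaf.map (homOfLE (X.basicOpen_le r)).op w =
      X.presheaf.map (homOfLE (X.basicOpen_le r)).op (r ^ n) • z := by
  have := hU.isLocalization_basicOpen r
  induction hz using Submodule.span_induction with
  | mem y hy =>
    obtain ⟨s, hs, rfl⟩ := hy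
    exact ⟨0, _, Submodule.subset_span ⟨s, hs, rfl⟩, by rw [map_resSection]; simp⟩
  | zero => exact ⟨0, 0, zero_mem _, by simp⟩
  | add y z _ _ hy hz =>
    obtain ⟨n, v, hv, hv'⟩ := hy
    obtain ⟨m, w, hw, hw'⟩ := hz
    refine ⟨n + m, r ^ m • v + r ^ n • w, add_mem (Submodule.smul_mem _ _ hv)
      (Submodule.smul_mem _ _ hw), ?_⟩
    rw [map_add, map_smul_section, map_smul_section, hv', hw', smul_smul, smul_smul, smul_add,
      ← map_mul, ← map_mul, ← pow_add, ← pow_add, add_comm m n]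
  | smul a y _ hy =>
    obtain ⟨n, v, hv, hv'⟩ := hy
    obtain ⟨⟨b, ⟨_, m, rfl⟩⟩, hb⟩ := IsLocalization.surj (Submonoid.powers r) a
    change a * X.presheaf.map (homOfLE (X.basicOpen_le r)).op (r ^ m) =
      X.presheaf.map (homOfLE (X.basicOpen_le r)).op b at hb
    refine ⟨m + n, b • v, Submodule.smul_mem _ _ hv, ?_⟩
    rw [map_smul_section, hv', ← hb, smul_smul, smul_smul, pow_add, map_mul]
    ring_nf

lemma exists_pow_smul_mem [IsIntegral X] (hL : IsLineBundle L) {U : X.Opens} (hU : IsAffineOpen U)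
    (r : Γ(X, U)) {y : Γ(L, U)} (hy : L.presheaf.map (homOfLE (X.basicOpen_le r)).op y ∈
      generatedSections π L F (X.basicOpen r)) :
    ∃ n : ℕ, r ^ n • y ∈ generatedSections π L F U := by
  rcases (X.basicOpen r : Set X).eq_empty_or_nonempty with h | h
  · have h0 : X.basicOpen r = ⊥ := TopologicalSpace.Opens.ext h
    rw [basicOpen_eq_bot_iff] at h0
    -- Here `r = 0`, so the exponent must be positive to kill `y`.
    exact ⟨1, by simp [h0]⟩
  · obtain ⟨n, w, hw, hw'⟩ := exists_pow_smul_eq_map hU r hy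
    refine ⟨n, ?_⟩
    rw [← map_smul_section] at hw'
    rwa [← hL.map_injective (X.basicOpen_le r) h hw']

variable (π L F) in
/-- The sections of `𝒪_X` over `U` that multiply `L(U)` into the sections generated by `F`. -/
def sectionIdeal (U : X.Opens) : Ideal Γ(X, U) where
  carrier := {a | ∀ t : Γ(L, U), a • t ∈ generatedSections π L F U}
  zero_mem' t := by simp
  add_mem' ha hb t := by rw [add_smul]; exact add_mem (ha t) (hb t)
  smul_mem' c a ha t := by rw [smul_assoc]; exact Submodule.smul_mem _ _ (ha t)

lemma IsFrame.mem_sectionIdeal_iff {V : X.Opens} {e : Γ(L, V)} (he : IsFrame L V e) {a : Γ(X, V)} :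
    a ∈ sectionIdeal π L F V ↔ a • e ∈ generatedSections π L F V := by
  refine ⟨fun h ↦ h e, fun h t ↦ ?_⟩
  obtain ⟨c, rfl⟩ := he.exists_eq_smul t
  rw [smul_comm]
  exact Submodule.smul_mem _ _ h

lemma IsFrame.map_mem_sectionIdeal {V W : X.Opens} {e : Γ(L, V)} (he : IsFrame L V e) (i : W ≤ V)
    {a : Γ(X, V)} (ha : a ∈ sectionIdeal π L F V) :
    X.presheaf.map (homOfLE i).op a ∈ sectionIdeal π L F W := by
  rw [(he.restrict i).mem_sectionIdeal_iff, ← map_smul_section]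
  exact map_mem_generatedSections i (ha e)

lemma IsFrame.exists_pow_mul_mem [IsIntegral X] (hL : IsLineBundle L) {V : X.Opens}
    (hV : IsAffineOpen V) {e : Γ(L, V)} (he : IsFrame L V e) (r : Γ(X, V)) {a : Γ(X, V)}
    (ha : X.presheaf.map (homOfLE (X.basicOpen_le r)).op a ∈
      sectionIdeal π L F (X.basicOpen r)) :
    ∃ n : ℕ, r ^ n * a ∈ sectionIdeal π L F V := by
  have := ha (L.presheaf.map (homOfLE (X.basicOpen_le r)).op e)
  rw [← map_smul_section] at this
  obtain ⟨n, hn⟩ := exists_pow_smul_mem hL hV r this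
  exact ⟨n, he.mem_sectionIdeal_iff.mpr (by rwa [mul_smul])⟩

/-- An ideal of sections over an affine open is everything if the basic opens of its elements
form a cover. -/
lemma _root_.AlgebraicGeometry.IsAffineOpen.ideal_eq_top {U : X.Opens} (hU : IsAffineOpen U)
    (I : Ideal Γ(X, U)) (h : ∀ x ∈ U, ∃ r : Γ(X, U), x ∈ X.basicOpen r ∧ ∃ n : ℕ, r ^ n ∈ I) :
    I = ⊤ := by
  rw [← Ideal.radical_eq_top, ← Ideal.span_eq I.radical, ← hU.self_le_iSup_basicOpen_iff]
  intro x hx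
  obtain ⟨r, hr, n, hn⟩ := h x hx
  exact TopologicalSpace.Opens.mem_iSup.mpr ⟨⟨r, n, hn⟩, hr⟩

variable (π L F) in
/-- The sections over `U` which lie in `sectionIdeal` locally. -/
def localIdeal (U : X.Opens) : Ideal Γ(X, U) where
  carrier := {a | ∀ (V : X.Opens) (i : V ≤ U), IsAffineOpen V → ∀ e : Γ(L, V), IsFrame L V e →
    X.presheaf.map (homOfLE i).op a ∈ sectionIdeal π L F V}
  zero_mem' V i _ e _ := by rw [map_zero]; exact zero_mem _
  add_mem' ha hb V i hV e he := by rw [map_add]; exact add_mem (ha V i hV e he) (hb V i hV e he)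
  smul_mem' c a ha V i hV e he := by
    rw [smul_eq_mul, map_mul]; exact Ideal.mul_mem_left _ _ (ha V i hV e he)

/-- The colon ideal of multipliers carrying `a` into `sectionIdeal` contains powers of functions
whose basic opens cover `V'`, so it contains `1`. These basic opens are chosen to be basic in both
affine opens. -/
lemma mem_localIdeal_of_locally [IsIntegral X] (hL : IsLineBundle L) {U : X.Opens} {a : Γ(X, U)}
    (h : ∀ x ∈ U, ∃ (V : X.Opens) (i : V ≤ U) (_ : x ∈ V) (_ : IsAffineOpen V) (e : Γ(L, V)),
      IsFrame L V e ∧ X.presheaf.map (homOfLE i).op a ∈ sectionIdeal π L F V) :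
    a ∈ localIdeal π L F U := by
  intro V' i' hV' e' he'
  set b := X.presheaf.map (homOfLE i').op a with hb
  let T : Ideal Γ(X, V') := (sectionIdeal π L F V').colon {b}
  suffices T = ⊤ by
    have h1 : (1 : Γ(X, V')) ∈ T := this ▸ Submodule.mem_top
    simpa [T, Submodule.mem_colon_singleton] using h1
  refine hV'.ideal_eq_top _ fun x hx ↦ ?_
  obtain ⟨V, i, hxV, hV, e, he, ha⟩ := h x (i' hx)
  obtain ⟨r, g, hrg, hxr⟩ := exists_basicOpen_le_affine_inter hV' hV x ⟨hx, hxV⟩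
  have hrV : X.basicOpen r ≤ V := hrg.trans_le (X.basicOpen_le g)
  have h1 := he.map_mem_sectionIdeal hrV ha
  rw [ring_map_map, ← ring_map_map (X.basicOpen_le r) i'] at h1
  obtain ⟨n, hn⟩ := he'.exists_pow_mul_mem hL hV' r h1
  exact ⟨r, hxr, n, by simpa [T, Submodule.mem_colon_singleton] using hn⟩

lemma localIdeal_smul_mem [IsIntegral X] (hL : IsLineBundle L) {U : X.Opens}
    (hU : IsAffineOpen U) {a : Γ(X, U)} (ha : a ∈ localIdeal π L F U) (t : Γ(L, U)) :
    a • t ∈ generatedSections π L F U := by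
  let T : Ideal Γ(X, U) := (generatedSections π L F U).colon {a • t}
  suffices T = ⊤ by
    have h1 : (1 : Γ(X, U)) ∈ T := this ▸ Submodule.mem_top
    simpa [T, Submodule.mem_colon_singleton] using h1
  refine hU.ideal_eq_top _ fun x hx ↦ ?_
  obtain ⟨V, e, hxV, hVU, he⟩ := exists_affine_isFrame hL hx
  obtain ⟨r, g, hrg, hxr⟩ := exists_basicOpen_le_affine_inter hU V.2 x ⟨hx, hxV⟩
  have hrV : X.basicOpen r ≤ V.1 := hrg.trans_le (X.basicOpen_le g)
  have h1 := ha _ (X.basicOpen_le r) (hU.basicOpen r) _ (he.restrict hrV)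
    (L.presheaf.map (homOfLE (X.basicOpen_le r)).op t)
  rw [← map_smul_section] at h1
  obtain ⟨n, hn⟩ := exists_pow_smul_mem hL hU r h1
  exact ⟨r, hxr, n, by simpa [T, Submodule.mem_colon_singleton] using hn⟩

/-- The exponent is found locally around each point; quasi-compactness of `U` makes it uniform. This
is the compatibility with localisation that makes `localIdeal` an ideal sheaf. -/
lemma exists_pow_mul_mem_localIdeal [IsIntegral X] (hL : IsLineBundle L) {U : X.Opens}
    (hU : IsAffineOpen U) (f a : Γ(X, U))
    (ha : X.presheaf.map (homOfLE (X.basicOpen_le f)).op a ∈ localIdeal π L F (X.basicOpen f)) :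
    ∃ n : ℕ, f ^ n * a ∈ localIdeal π L F U := by
  have key : ∃ n : ℕ, ∀ x ∈ (U : Set X), ∃ (V : X.Opens) (i : V ≤ U) (_ : x ∈ V)
      (_ : IsAffineOpen V) (e : Γ(L, V)),
      IsFrame L V e ∧ X.presheaf.map (homOfLE i).op (f ^ n * a) ∈ sectionIdeal π L F V := by
    refine hU.isCompact.induction_on (p := fun s : Set X ↦ ∃ n : ℕ, ∀ x ∈ s,
      ∃ (V : X.Opens) (i : V ≤ U) (_ : x ∈ V) (_ : IsAffineOpen V) (e : Γ(L, V)),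
      IsFrame L V e ∧ X.presheaf.map (homOfLE i).op (f ^ n * a) ∈ sectionIdeal π L F V)
      ⟨0, by simp⟩ ?_ ?_ ?_
    · rintro s t hst ⟨n, hn⟩
      exact ⟨n, fun x hx ↦ hn x (hst hx)⟩
    · rintro s t ⟨n, hn⟩ ⟨m, hm⟩
      refine ⟨n + m, fun x hx ↦ ?_⟩
      rcases hx with hx | hx
      · obtain ⟨V, i, hxV, hV, e, he, h⟩ := hn x hx
        refine ⟨V, i, hxV, hV, e, he, ?_⟩
        rw [add_comm, pow_add, mul_assoc, map_mul]
        exact Ideal.mul_mem_left _ _ h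
      · obtain ⟨V, i, hxV, hV, e, he, h⟩ := hm x hx
        refine ⟨V, i, hxV, hV, e, he, ?_⟩
        rw [pow_add, mul_assoc, map_mul]
        exact Ideal.mul_mem_left _ _ h
    · intro x hx
      obtain ⟨V, e, hxV, hVU, he⟩ := exists_affine_isFrame hL hx
      have hle : X.basicOpen (X.presheaf.map (homOfLE hVU).op f) ≤ X.basicOpen f := by
        rw [Scheme.basicOpen_res]; exact inf_le_right
      have h1 := ha _ hle (V.2.basicOpen _) _ (he.restrict (X.basicOpen_le _))
      rw [ring_map_map, ← ring_map_map (X.basicOpen_le _) hVU] at h1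
      obtain ⟨n, hn⟩ := he.exists_pow_mul_mem hL V.2 _ h1
      refine ⟨V.1, mem_nhdsWithin_of_mem_nhds (V.1.isOpen.mem_nhds hxV), n, fun y hy ↦
        ⟨V.1, hVU, hy, V.2, e, he, ?_⟩⟩
      rwa [map_mul, map_pow]
  obtain ⟨n, hn⟩ := key
  exact ⟨n, mem_localIdeal_of_locally hL hn⟩

variable (π F) in
/-- The ideal sheaf of base points, constructed from local data. -/
def localIdealSheaf [IsIntegral X] (hL : IsLineBundle L) : X.IdealSheafData where
  ideal U := localIdeal π L F U
  map_ideal_basicOpen U f := by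
    have := U.2.isLocalization_basicOpen f
    apply le_antisymm
    · refine Ideal.map_le_iff_le_comap.mpr ?_
      intro a ha V (i : V ≤ X.basicOpen f) hV e he
      have := ha V (i.trans (X.basicOpen_le f)) hV e he
      rwa [← ring_map_map i (X.basicOpen_le f)] at this
    · intro b hb
      obtain ⟨⟨a, ⟨_, m, rfl⟩⟩, hab⟩ := IsLocalization.surj (Submonoid.powers f) b
      change b * X.presheaf.map (homOfLE (X.basicOpen_le f)).op (f ^ m) =
        X.presheaf.map (homOfLE (X.basicOpen_le f)).op a at hab
      have ha : X.presheaf.map (homOfLE (X.basicOpen_le f)).op a ∈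
          localIdeal π L F (X.basicOpen f) := by
        rw [← hab]
        exact Ideal.mul_mem_right _ _ hb
      obtain ⟨n, hn⟩ := exists_pow_mul_mem_localIdeal hL U.2 f a ha
      refine (IsLocalization.mem_map_algebraMap_iff (Submonoid.powers f) _).mpr
        ⟨⟨⟨_, hn⟩, ⟨f ^ (n + m), n + m, rfl⟩⟩, ?_⟩
      change b * X.presheaf.map (homOfLE (X.basicOpen_le f)).op (f ^ (n + m)) =
        X.presheaf.map (homOfLE (X.basicOpen_le f)).op (f ^ n * a)
      rw [map_mul, ← hab, pow_add, map_mul]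
      ring

/-- Suprema of ideal sheaves are computed on affine opens, which gives one inclusion. For the other,
`localIdealSheaf` belongs to the family whose supremum is taken, and over `V` it contains
`sectionIdeal`. -/
lemma IsFrame.baseIdeal_ideal [IsIntegral X] (hL : IsLineBundle L) (V : X.affineOpens)
    {e : Γ(L, V)} (he : IsFrame L V e) :
    (baseIdeal π L F).ideal V = sectionIdeal π L F V := by
  apply le_antisymm
  · rw [baseIdeal, Scheme.IdealSheafData.ideal_sSup, sSup_apply]
    refine iSup_le ?_
    rintro ⟨_, I, hI, rfl⟩ a ha t
    exact hI V (Submodule.smul_mem_smul ha Submodule.mem_top)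
  · have h1 : localIdealSheaf π F hL ≤ baseIdeal π L F := by
      refine le_sSup fun U ↦ ?_
      rw [Submodule.smul_le]
      exact fun a ha t _ ↦ localIdeal_smul_mem hL U.2 ha t
    refine le_trans ?_ (h1 V)
    exact fun a ha W i hW e' he' ↦ he.map_mem_sectionIdeal i ha

end BaseIdeal

end BasePoints

/-! ### Pullback of ideal sheaves in affine charts -/

namespace AlgebraicGeometry.Scheme.IdealSheafData
variable {X Y : Scheme.{u}}

/-- Both inclusions come from the adjunction between `comap` and `map`, since `map` along an affine
morphism is contraction of ideals. -/
lemma ideal_comap_top_of_isAffine [IsAffine X] [IsAffine Y] (I : Y.IdealSheafData) (f : X ⟶ Y) :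
    (I.comap f).ideal ⟨⊤, isAffineOpen_top X⟩ =
      (I.ideal ⟨⊤, isAffineOpen_top Y⟩).map f.appTop.hom := by
  apply le_antisymm
  · have h : I.comap f ≤ ofIdealTop ((I.ideal ⟨⊤, isAffineOpen_top Y⟩).map f.appTop.hom) := by
      rw [← le_map_iff_comap_le]
      apply le_of_isAffine
      rw [ideal_map_of_isAffineHom]
      refine Ideal.map_le_iff_le_comap.mp ?_
      refine le_trans (le_of_eq ?_) (equivOfIsAffine.apply_symm_apply
        ((I.ideal ⟨⊤, isAffineOpen_top Y⟩).map f.appTop.hom)).ge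
      rfl
    exact (h _).trans_eq (equivOfIsAffine.apply_symm_apply _)
  · rw [Ideal.map_le_iff_le_comap]
    have := I.le_map_comap f ⟨⊤, isAffineOpen_top Y⟩
    rwa [ideal_map_of_isAffineHom] at this

lemma ideal_comap_ι_top (I : X.IdealSheafData) (U : X.affineOpens) [IsAffine U.1] :
    (I.comap U.1.ι).ideal ⟨⊤, isAffineOpen_top _⟩ = (I.ideal U).map U.1.topIso.inv.hom := by
  have h := I.map_ideal' (U := ⟨U.1.ι ''ᵁ ⊤, (isAffineOpen_top _).image_of_isOpenImmersion U.1.ι⟩)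
    (V := U) (eqToHom U.1.ι_image_top).op
  rw [ideal_comap_of_isOpenImmersion, Opens.ι_appIso, ← h]
  exact Ideal.comap_id _

/-- Restricting `f` to `V ⟶ U` reduces this to a morphism of affine schemes. -/
lemma ideal_comap_of_le (I : Y.IdealSheafData) (f : X ⟶ Y) (U : Y.affineOpens) (V : X.affineOpens)
    (h : V.1 ≤ f ⁻¹ᵁ U.1) :
    (I.comap f).ideal V = (I.ideal U).map (f.appLE U V h).hom := by
  have : IsAffine V.1 := V.2
  have : IsAffine U.1 := U.2
  have h1 : ((I.comap f).comap V.1.ι).ideal ⟨⊤, isAffineOpen_top _⟩ =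
      ((I.comap U.1.ι).comap (f.resLE U.1 V.1 h)).ideal ⟨⊤, isAffineOpen_top _⟩ := by
    rw [← comap_comp, ← comap_comp, Scheme.Hom.resLE_comp_ι]
  rw [ideal_comap_top_of_isAffine (I.comap U.1.ι), ideal_comap_ι_top, ideal_comap_ι_top,
    Ideal.map_map, ← CommRingCat.hom_comp, Scheme.Hom.appTop, Scheme.Hom.resLE_app_top,
    Iso.inv_hom_id_assoc] at h1
  have h2 := congrArg (Ideal.map V.1.topIso.hom.hom) h1
  rw [Ideal.map_map, Ideal.map_map, ← CommRingCat.hom_comp, ← CommRingCat.hom_comp,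
    Category.assoc, Iso.inv_hom_id, Category.comp_id] at h2
  rw [← h2]
  exact (Ideal.map_id _).symm

end AlgebraicGeometry.Scheme.IdealSheafData

/-! ### Evaluation at the generic point of a section -/

noncomputable section
namespace BasePoints

section GenericPoint
variable (R : Type u) [CommRing R] [IsDomain R] (K : Type u) [Field K] [Algebra R K]
  [IsFractionRing R K]

/-- The generic point of the spectrum of a domain. -/
abbrev genPt : Spec (CommRingCat.of R) := (⊥ : PrimeSpectrum R)

/-- The map from the stalk at the generic point to the fraction field. -/
def stalkToField : (Spec (CommRingCat.of R)).presheaf.stalk (genPt R) →+* K :=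
  IsLocalization.lift (S := (Spec.structureSheaf R).presheaf.stalk (⊥ : PrimeSpectrum R))
    (M := (⊥ : PrimeSpectrum R).asIdeal.primeCompl) (g := algebraMap R K) fun y ↦
    IsUnit.mk0 _ fun h ↦ y.2 (by simpa using h)

/-- Sections over an open containing the generic point, as elements of the fraction field. -/
def toField (W : (Spec (CommRingCat.of R)).Opens) (hW : genPt R ∈ W) :
    Γ(Spec (CommRingCat.of R), W) →+* K :=
  (stalkToField R K).comp ((Spec (CommRingCat.of R)).presheaf.germ W (genPt R) hW).hom

variable {R K}
lemma toField_map {W W' : (Spec (CommRingCat.of R)).Opens} (i : W' ≤ W) (hW : genPt R ∈ W')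
    (z : Γ(Spec (CommRingCat.of R), W)) :
    toField R K W' hW ((Spec (CommRingCat.of R)).presheaf.map (homOfLE i).op z) =
      toField R K W (i hW) z := by
  simp only [toField, RingHom.comp_apply]
  congr 1
  exact TopCat.Presheaf.germ_res_apply _ _ _ _ _

lemma toField_algebraMap (r : R) :
    toField R K ⊤ trivial ((Scheme.ΓSpecIso (CommRingCat.of R)).inv r) = algebraMap R K r := by
  simp only [toField, RingHom.comp_apply]
  exact IsLocalization.lift_eq
    (S := (Spec.structureSheaf R).presheaf.stalk (⊥ : PrimeSpectrum R))
    (M := (⊥ : PrimeSpectrum R).asIdeal.primeCompl) (g := algebraMap R K) _ r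

lemma exists_pow_mul_toField (h : R)
    (hD : genPt R ∈ (Spec (CommRingCat.of R)).basicOpen ((Scheme.ΓSpecIso (CommRingCat.of R)).inv h))
    (z : Γ(Spec (CommRingCat.of R),
      (Spec (CommRingCat.of R)).basicOpen ((Scheme.ΓSpecIso (CommRingCat.of R)).inv h))) :
    ∃ (n : ℕ) (r : R), algebraMap R K (h ^ n) * toField R K _ hD z = algebraMap R K r := by
  have := (isAffineOpen_top (Spec (CommRingCat.of R))).isLocalization_basicOpen
    ((Scheme.ΓSpecIso (CommRingCat.of R)).inv h)
  obtain ⟨⟨w, ⟨_, n, rfl⟩⟩, hw⟩ := IsLocalization.surj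
    (Submonoid.powers ((Scheme.ΓSpecIso (CommRingCat.of R)).inv h)) z
  obtain ⟨x, rfl⟩ : ∃ x : R, (Scheme.ΓSpecIso (CommRingCat.of R)).inv x = w :=
    ⟨(Scheme.ΓSpecIso (CommRingCat.of R)).hom w,
      congr($((Scheme.ΓSpecIso (CommRingCat.of R)).hom_inv_id) w)⟩
  have hval : ∀ y : R, toField R K _ hD ((Spec (CommRingCat.of R)).presheaf.map
      (homOfLE le_top).op ((Scheme.ΓSpecIso (CommRingCat.of R)).inv y)) = algebraMap R K y :=
    fun y ↦ (toField_map le_top hD _).trans (toField_algebraMap y)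
  refine ⟨n, x, ?_⟩
  have h2 := congrArg (toField R K _ hD) hw
  rw [map_mul] at h2
  rw [← hval, ← hval, mul_comm]
  refine Eq.trans ?_ h2
  congr 2
  simp only [map_pow]
  rfl

lemma genPt_mem {W : (Spec (CommRingCat.of R)).Opens} {x : Spec (CommRingCat.of R)} (hx : x ∈ W) :
    genPt R ∈ W :=
  ((PrimeSpectrum.le_iff_specializes (⊥ : PrimeSpectrum R) x).mp bot_le).mem_open W.isOpen hx

end GenericPoint

section Evaluation

variable {R : Type u} [CommRing R] [IsDomain R] (K : Type u) [Field K] [Algebra R K]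
  [IsFractionRing R K] {X : Scheme.{u}} (P : Spec (CommRingCat.of R) ⟶ X)

/-- Evaluation of functions on `V` at the generic point of the section `P`. -/
def evalAt (V : X.Opens) (hV : P (genPt R) ∈ V) : Γ(X, V) →+* K :=
  (toField R K (P ⁻¹ᵁ V) hV).comp (P.app V).hom

variable {K P}

lemma evalAt_map {V V' : X.Opens} (i : V' ≤ V) (hV : P (genPt R) ∈ V') (a : Γ(X, V)) :
    evalAt K P V' hV (X.presheaf.map (homOfLE i).op a) = evalAt K P V (i hV) a := by
  have h := congr($(P.naturality (homOfLE i).op) a)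
  simp only [evalAt, RingHom.comp_apply]
  refine (congrArg _ h).trans ?_
  exact toField_map (fun x hx ↦ i hx) hV _

lemma toField_appLE {V : X.Opens} {W : (Spec (CommRingCat.of R)).Opens} (i : W ≤ P ⁻¹ᵁ V)
    (hW : genPt R ∈ W) (a : Γ(X, V)) :
    toField R K W hW (P.appLE V W i a) = evalAt K P V (i hW) a :=
  toField_map i hW _

/-- This is where `P` being a section of `π` enters: it makes evaluation linear over the base ring.
-/
lemma evalAt_app {π : X ⟶ Spec (CommRingCat.of R)} (hP : P ≫ π = 𝟙 _) (r : R) :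
    evalAt K P ⊤ trivial (π.appTop ((Scheme.ΓSpecIso (CommRingCat.of R)).inv r)) =
      algebraMap R K r := by
  have h : ∀ z, P.appTop (π.appTop z) = z := by
    intro z
    rw [← CommRingCat.comp_apply, ← Scheme.Hom.comp_appTop, hP]
    simp
  simp only [evalAt, RingHom.comp_apply]
  refine (congrArg _ (h _)).trans (toField_algebraMap r)

end Evaluation

section Coord
variable {X : Scheme.{u}} {L : X.Modules}

/-- The coordinate of a section with respect to a frame. -/
def IsFrame.coord {V : X.Opens} {e : Γ(L, V)} (he : IsFrame L V e) (s : Γ(L, V)) : Γ(X, V) :=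
  (he.exists_eq_smul s).choose

lemma IsFrame.coord_smul {V : X.Opens} {e : Γ(L, V)} (he : IsFrame L V e) (s : Γ(L, V)) :
    he.coord s • e = s :=
  (he.exists_eq_smul s).choose_spec

lemma IsFrame.coord_eq_iff {V : X.Opens} {e : Γ(L, V)} (he : IsFrame L V e) {s : Γ(L, V)}
    {a : Γ(X, V)} : he.coord s = a ↔ s = a • e := by
  refine ⟨fun h ↦ h ▸ (he.coord_smul s).symm, fun h ↦ he.smul_injective ?_⟩
  simp only [he.coord_smul, h]

lemma IsFrame.map_coord {V W : X.Opens} {e : Γ(L, V)} (he : IsFrame L V e) (i : W ≤ V)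
    (s : Γ(L, V)) : X.presheaf.map (homOfLE i).op (he.coord s) =
      (he.restrict i).coord (L.presheaf.map (homOfLE i).op s) := by
  rw [eq_comm, IsFrame.coord_eq_iff, ← map_smul_section, he.coord_smul]

end Coord

/-! ### The ideal of `P^* B_F` in terms of values in `K` -/

section Fibre

variable {K : Type u} [Field K] [NumberField K] {X : Scheme.{u}}
  {π : X ⟶ Spec (CommRingCat.of (𝓞 K))} {L : X.Modules}
  {F : Submodule (𝓞 K) (pushSections π L)} {P : Spec (CommRingCat.of (𝓞 K)) ⟶ X}

omit [NumberField K] in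
lemma resSection_smul (U : X.Opens) (r : 𝓞 K) (s : pushSections π L) :
    resSection π L U (r • s) = X.presheaf.map (homOfLE (le_top : U ≤ ⊤)).op
      (π.appTop ((Scheme.ΓSpecIso (CommRingCat.of (𝓞 K))).inv r)) • resSection π L U s :=
  map_smul_section (V := ⊤) (W := U) (show Γ(L, ⊤) from s) le_top _

/-- Global sections of `L`, evaluated at the generic point of `P` in terms of a frame. -/
def IsFrame.eval {V : X.Opens} {e : Γ(L, V)} (he : IsFrame L V e) (hP : P ≫ π = 𝟙 _)
    (hV : P (genPt (𝓞 K)) ∈ V) : pushSections π L →ₗ[𝓞 K] K where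
  toFun s := evalAt K P V hV (he.coord (resSection π L V s))
  map_add' s t := by
    rw [← map_add]
    congr 1
    rw [IsFrame.coord_eq_iff, add_smul, he.coord_smul, he.coord_smul]
    exact map_add _ _ _
  map_smul' r s := by
    rw [RingHom.id_apply, Algebra.smul_def, ← evalAt_app hP r,
      ← evalAt_map (le_top : V ≤ ⊤) hV, ← map_mul]
    congr 1
    rw [IsFrame.coord_eq_iff, mul_smul, he.coord_smul, resSection_smul]

lemma IsFrame.eval_restrict {V W : X.Opens} {e : Γ(L, V)} (he : IsFrame L V e)
    (hP : P ≫ π = 𝟙 _) (i : W ≤ V) (hW : P (genPt (𝓞 K)) ∈ W) (s : pushSections π L) :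
    (he.restrict i).eval hP hW s = he.eval hP (i hW) s := by
  change evalAt K P W hW _ = evalAt K P V _ _
  rw [← evalAt_map i hW, he.map_coord, map_resSection]

/-- The scalar is the value at the generic point of the transition function between the frames, a
unit on `V ⊓ V'`. -/
lemma IsFrame.exists_eval_eq_mul {V V' : X.Opens} {e : Γ(L, V)} {e' : Γ(L, V')}
    (he : IsFrame L V e) (he' : IsFrame L V' e') (hP : P ≫ π = 𝟙 _)
    (hV : P (genPt (𝓞 K)) ∈ V) (hV' : P (genPt (𝓞 K)) ∈ V') :
    ∃ u : K, u ≠ 0 ∧ ∀ s : pushSections π L, he'.eval hP hV' s = u * he.eval hP hV s := by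
  have hW : P (genPt (𝓞 K)) ∈ V ⊓ V' := ⟨hV, hV'⟩
  have h1 := he.restrict (inf_le_left : V ⊓ V' ≤ V)
  have h2 := he'.restrict (inf_le_right : V ⊓ V' ≤ V')
  set f := L.presheaf.map (homOfLE (inf_le_left : V ⊓ V' ≤ V)).op e
  set f' := L.presheaf.map (homOfLE (inf_le_right : V ⊓ V' ≤ V')).op e'
  refine ⟨evalAt K P _ hW (h2.coord f), ?_, fun s ↦ ?_⟩
  · have h : h1.coord f' * h2.coord f = 1 := by
      apply h2.smul_injective
      simp only [mul_smul, h2.coord_smul, h1.coord_smul, one_smul]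
    intro h0
    have := congrArg (evalAt K P _ hW) h
    simp [h0] at this
  · rw [← he.eval_restrict hP inf_le_left hW, ← he'.eval_restrict hP inf_le_right hW]
    change evalAt K P _ hW _ = _ * evalAt K P _ hW _
    rw [← map_mul]
    congr 1
    rw [IsFrame.coord_eq_iff, mul_comm, mul_smul, h2.coord_smul, h1.coord_smul]

omit [NumberField K] in
lemma IsFrame.sectionIdeal_eq_span {V : X.Opens} {e : Γ(L, V)} (he : IsFrame L V e) :
    sectionIdeal π L F V =
      Ideal.span ((fun s ↦ he.coord (resSection π L V s)) '' (F : Set (pushSections π L))) := by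
  have h : generatedSections π L F V = Submodule.map
      (LinearMap.toSpanSingleton Γ(X, V) Γ(L, V) e) (Submodule.span Γ(X, V)
      ((fun s ↦ he.coord (resSection π L V s)) '' (F : Set (pushSections π L)))) := by
    rw [Submodule.map_span, ← Set.image_comp, generatedSections]
    congr 1
    refine Set.image_congr fun s _ ↦ ?_
    exact (he.coord_smul _).symm
  ext a
  rw [he.mem_sectionIdeal_iff, h]
  constructor
  · rintro ⟨b, hb, hab⟩
    rwa [← he.smul_injective hab]
  · exact fun ha ↦ ⟨a, ha, rfl⟩

/-- Near the image of the generic point the coordinates of `F` generate the unit ideal, so they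
cannot all lie in the kernel of evaluation. -/
lemma exists_eval_ne_zero (hgen : GeneratesGenerically π L F) {V : X.Opens} {e : Γ(L, V)}
    (he : IsFrame L V e) (hP : P ≫ π = 𝟙 _) (hV : P (genPt (𝓞 K)) ∈ V) :
    ∃ s ∈ F, he.eval hP hV s ≠ 0 := by
  have hπ : π (P (genPt (𝓞 K))) = (⊥ : PrimeSpectrum (𝓞 K)) := by
    rw [← Scheme.Hom.comp_apply, hP]; rfl
  obtain ⟨W, i, hW, h⟩ := hgen _ hπ V hV e
  have h1 : (1 : Γ(X, W)) ∈ sectionIdeal π L F W := by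
    rwa [(he.restrict i).mem_sectionIdeal_iff, one_smul]
  rw [(he.restrict i).sectionIdeal_eq_span] at h1
  by_contra! h0
  have h2 : Ideal.span ((fun s ↦ (he.restrict i).coord (resSection π L W s)) ''
      (F : Set (pushSections π L))) ≤ RingHom.ker (evalAt K P W hW) := by
    rw [Ideal.span_le]
    rintro _ ⟨s, hs, rfl⟩
    exact (he.eval_restrict hP i hW s).trans (h0 s hs)
  simpa using h2 h1

/-- Over a basic open `D(h)` mapping into the domain of a frame, the ideal of `P^* B_F` is generated
by the values of `F` in this frame. -/
lemma IsFrame.exists_pow_smul_eval [IsIntegral X] (hL : IsLineBundle L) (V : X.affineOpens)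
    {e : Γ(L, V)} (he : IsFrame L V e) (hP : P ≫ π = 𝟙 _) (h : 𝓞 K)
    (hD : genPt (𝓞 K) ∈ (Spec (CommRingCat.of (𝓞 K))).basicOpen
      ((Scheme.ΓSpecIso (CommRingCat.of (𝓞 K))).inv h))
    (hle : (Spec (CommRingCat.of (𝓞 K))).basicOpen
      ((Scheme.ΓSpecIso (CommRingCat.of (𝓞 K))).inv h) ≤ P ⁻¹ᵁ V.1) :
    (∀ x ∈ pullbackIdeal π L F P, ∃ n : ℕ, ∃ s ∈ F,
      algebraMap (𝓞 K) K (h ^ n * x) = he.eval hP (hle hD) s) ∧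
    (∀ s ∈ F, ∃ n : ℕ, ∃ x ∈ pullbackIdeal π L F P,
      algebraMap (𝓞 K) K (h ^ n) * he.eval hP (hle hD) s = algebraMap (𝓞 K) K x) := by
  set g := (Scheme.ΓSpecIso (CommRingCat.of (𝓞 K))).inv h with hg
  let D : (Spec (CommRingCat.of (𝓞 K))).affineOpens := ⟨_, (isAffineOpen_top _).basicOpen g⟩
  let T : (Spec (CommRingCat.of (𝓞 K))).affineOpens := ⟨⊤, isAffineOpen_top _⟩
  let I := (baseIdeal π L F).comap P
  have hI : I.ideal D = Ideal.span ((P.appLE V D hle).hom ''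
      ((fun s ↦ he.coord (resSection π L V s)) '' (F : Set (pushSections π L)))) := by
    rw [Scheme.IdealSheafData.ideal_comap_of_le _ P V D hle, he.baseIdeal_ideal hL V,
      he.sectionIdeal_eq_span, Ideal.map_span]
  have hres : (I.ideal T).map ((Spec (CommRingCat.of (𝓞 K))).presheaf.map
      (homOfLE (le_top : D.1 ≤ ⊤)).op).hom = I.ideal D := I.map_ideal (U := D) (V := T) _
  constructor
  · intro x hx
    have hx' : (Scheme.ΓSpecIso (CommRingCat.of (𝓞 K))).inv x ∈ I.ideal T := hx
    -- Coefficients over `D(h)` become elements of `𝓞 K` after multiplication by powers of `h`, so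
    -- they can be absorbed into the module `F`.
    have key : ∀ y ∈ I.ideal D, ∃ n : ℕ, ∃ s ∈ F, algebraMap (𝓞 K) K (h ^ n) *
        toField (𝓞 K) K D.1 hD y = he.eval hP (hle hD) s := by
      intro y hy
      rw [hI] at hy
      induction hy using Submodule.span_induction with
      | mem y hy =>
        obtain ⟨_, ⟨s, hs, rfl⟩, rfl⟩ := hy
        refine ⟨0, s, hs, ?_⟩
        rw [pow_zero, map_one, one_mul]
        exact toField_appLE hle hD _
      | zero => exact ⟨0, 0, zero_mem _, by simp⟩
      | add y z _ _ hy hz =>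
        obtain ⟨n, s, hs, hs'⟩ := hy
        obtain ⟨m, t, ht, ht'⟩ := hz
        refine ⟨n + m, h ^ m • s + h ^ n • t,
          add_mem (F.smul_mem _ hs) (F.smul_mem _ ht), ?_⟩
        rw [map_add, map_add, map_smul, map_smul, ← hs', ← ht', Algebra.smul_def,
          Algebra.smul_def, pow_add, map_mul]
        ring
      | smul a y _ hy =>
        obtain ⟨n, s, hs, hs'⟩ := hy
        obtain ⟨m, r, hr⟩ := exists_pow_mul_toField (K := K) h hD a
        refine ⟨m + n, r • s, F.smul_mem _ hs, ?_⟩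
        have hr' : algebraMap (𝓞 K) K (h ^ m) * toField (𝓞 K) K D.1 hD a = algebraMap (𝓞 K) K r :=
          hr
        rw [(he.eval hP (hle hD)).map_smul r s, ← hs', smul_eq_mul, Algebra.smul_def r, ← hr',
          map_mul (toField (𝓞 K) K D.1 hD), pow_add, map_mul]
        ring
    obtain ⟨n, s, hs, h1⟩ := key _ (hres.le (Ideal.mem_map_of_mem _ hx'))
    refine ⟨n, s, hs, ?_⟩
    rw [← h1, map_mul]
    congr 1
    exact ((toField_map (K := K) le_top hD _).trans (toField_algebraMap x)).symm
  · intro s hs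
    have hy : P.appLE V D hle (he.coord (resSection π L V s)) ∈ I.ideal D := by
      rw [hI]
      exact Ideal.subset_span ⟨_, ⟨s, hs, rfl⟩, rfl⟩
    have := (isAffineOpen_top (Spec (CommRingCat.of (𝓞 K)))).isLocalization_basicOpen g
    rw [← hres] at hy
    obtain ⟨⟨⟨w, hw⟩, ⟨_, n, rfl⟩⟩, hy⟩ :=
      (IsLocalization.mem_map_algebraMap_iff (Submonoid.powers g) _).mp hy
    obtain ⟨x, rfl⟩ : ∃ x : 𝓞 K, (Scheme.ΓSpecIso (CommRingCat.of (𝓞 K))).inv x = w :=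
      ⟨(Scheme.ΓSpecIso (CommRingCat.of (𝓞 K))).hom w,
        congr($((Scheme.ΓSpecIso (CommRingCat.of (𝓞 K))).hom_inv_id) w)⟩
    refine ⟨n, x, hw, ?_⟩
    have h2 := congrArg (toField (𝓞 K) K D.1 hD) hy
    rw [map_mul] at h2
    have h3 : toField (𝓞 K) K D.1 hD ((Spec (CommRingCat.of (𝓞 K))).presheaf.map
        (homOfLE (le_top : D.1 ≤ ⊤)).op (g ^ n)) = algebraMap (𝓞 K) K (h ^ n) := by
      rw [hg, ← map_pow]
      exact (toField_map le_top hD _).trans (toField_algebraMap _)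
    have h4 : toField (𝓞 K) K D.1 hD ((Spec (CommRingCat.of (𝓞 K))).presheaf.map
        (homOfLE (le_top : D.1 ≤ ⊤)).op ((Scheme.ΓSpecIso (CommRingCat.of (𝓞 K))).inv x)) =
        algebraMap (𝓞 K) K x :=
      (toField_map le_top hD _).trans (toField_algebraMap _)
    rw [← h3, ← h4, mul_comm]
    refine Eq.trans ?_ h2
    congr 1
    exact (toField_appLE hle hD _).symm

end Fibre
end BasePoints
end

/-! ### Valuations, norms and indices over Dedekind domains -/

noncomputable section
namespace BasePoints

open scoped TensorProduct

section Arithmetic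
variable {R : Type*} [CommRing R] [IsDedekindDomain R] {K : Type*} [Field K] [Algebra R K]
  [IsFractionRing R K]

lemma count_span_singleton_eq_zero (v : HeightOneSpectrum R) {a : R} (ha : a ∉ v.asIdeal) :
    FractionalIdeal.count K v (FractionalIdeal.spanSingleton R⁰ (algebraMap R K a)) = 0 := by
  classical
  have h0 : Ideal.span {a} ≠ 0 := by
    rintro h
    rw [Ideal.zero_eq_bot, Ideal.span_singleton_eq_bot] at h
    exact ha (h ▸ zero_mem _)
  rw [← FractionalIdeal.coeIdeal_span_singleton, FractionalIdeal.count_coe K v h0]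
  by_contra h
  have h' := (Associates.count_ne_zero_iff_dvd h0 v.irreducible).mp (by exact_mod_cast h)
  exact ha (Ideal.dvd_span_singleton.mp h')

/-- As `I` is finitely generated, one power `h ^ N` carries all of it into `J`, and `h ^ N` has
valuation zero at `v`. -/
lemma count_le_count_of_locally (v : HeightOneSpectrum R) {h : R} (hv : h ∉ v.asIdeal)
    {I J : FractionalIdeal R⁰ K} (hI : I ≠ 0)
    (H : ∀ x ∈ I, ∃ n : ℕ, algebraMap R K (h ^ n) * x ∈ J) :
    FractionalIdeal.count K v J ≤ FractionalIdeal.count K v I := by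
  obtain ⟨S, hS⟩ : (I : Submodule R K).FG := by
    have := FractionalIdeal.isNoetherian I
    exact Module.Finite.iff_fg.mp inferInstance
  have H' : ∀ x ∈ S, ∃ n : ℕ, algebraMap R K (h ^ n) * x ∈ J := fun x hx ↦
    H x (show x ∈ (I : Submodule R K) from hS ▸ Submodule.subset_span hx)
  choose! n hn using H'
  obtain ⟨N, hN⟩ : ∃ N, ∀ x ∈ S, n x ≤ N := ⟨S.sup n, fun x hx ↦ Finset.le_sup hx⟩
  have hle : FractionalIdeal.spanSingleton R⁰ (algebraMap R K (h ^ N)) * I ≤ J := by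
    rw [FractionalIdeal.spanSingleton_mul_le_iff]
    intro z hz
    have hz' : z ∈ Submodule.span R (S : Set K) := by rw [hS]; exact hz
    have hsp : Submodule.span R (S : Set K) ≤ (J : Submodule R K).comap
        (LinearMap.mulLeft R (algebraMap R K (h ^ N))) := by
      rw [Submodule.span_le]
      intro x hx
      obtain ⟨k, hk⟩ := Nat.exists_eq_add_of_le (hN x hx)
      have := (J : Submodule R K).smul_mem (h ^ k) (hn x hx)
      simp only [Submodule.comap_coe, Set.mem_preimage, LinearMap.mulLeft_apply, SetLike.mem_coe]
      rw [hk, pow_add, mul_comm (h ^ n x), map_mul, mul_assoc]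
      rwa [Algebra.smul_def] at this
    exact hsp hz'
  have hh : h ^ N ∉ v.asIdeal := fun hm ↦ hv (v.isPrime.mem_of_pow_mem _ hm)
  have h0 : FractionalIdeal.spanSingleton R⁰ (algebraMap R K (h ^ N)) ≠ 0 := by
    rw [FractionalIdeal.spanSingleton_ne_zero_iff]
    intro hz
    rw [FaithfulSMul.algebraMap_eq_zero_iff] at hz
    exact hh (hz ▸ zero_mem _)
  have := FractionalIdeal.count_mono K v (mul_ne_zero h0 hI) hle
  rwa [FractionalIdeal.count_mul K v h0 hI, count_span_singleton_eq_zero v hh, zero_add] at this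

variable [Module.Free ℤ R]

lemma log_absNorm_eq_finsum [Module.Finite ℤ R] (I : Ideal R) (hI : I ≠ ⊥) :
    Real.log (Ideal.absNorm I) = ∑ᶠ v : HeightOneSpectrum R,
      (FractionalIdeal.count K v (I : FractionalIdeal R⁰ K) : ℝ) *
        Real.log (Ideal.absNorm v.asIdeal) := by
  classical
  have hfin : (Function.mulSupport fun v : HeightOneSpectrum R ↦ v.maxPowDividing I).Finite :=
    Ideal.hasFiniteMulSupport hI
  have h1 : Ideal.absNorm I =
      ∏ v ∈ hfin.toFinset, Ideal.absNorm (v.maxPowDividing I) := by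
    conv_lhs => rw [← Ideal.finprod_heightOneSpectrum_factorization hI]
    rw [finprod_eq_prod _ hfin, map_prod]
  have h2 : ∀ v : HeightOneSpectrum R, Real.log (Ideal.absNorm (v.maxPowDividing I)) =
      (FractionalIdeal.count K v (I : FractionalIdeal R⁰ K) : ℝ) *
        Real.log (Ideal.absNorm v.asIdeal) := by
    intro v
    rw [FractionalIdeal.count_coe K v hI, HeightOneSpectrum.maxPowDividing, map_pow, Nat.cast_pow,
      Real.log_pow, Int.cast_natCast]
  rw [h1, Nat.cast_prod, Real.log_prod, finsum_eq_sum_of_support_subset]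
  · exact Finset.sum_congr rfl fun v _ ↦ h2 v
  · intro v hv
    rw [Set.Finite.coe_toFinset, Function.mem_mulSupport]
    intro h
    rw [Function.mem_support, ← h2, h] at hv
    simp at hv
  · intro v _
    rw [Nat.cast_ne_zero, Ne, Ideal.absNorm_eq_zero_iff, HeightOneSpectrum.maxPowDividing]
    exact pow_ne_zero _ v.ne_bot

omit [IsFractionRing R K] in
/-- Index bound for ideals obtained as images of a pair of modules under a linear map. -/
lemma absNorm_le_mul_card {M : Type*} [AddCommGroup M] [Module R M] (φ : M →ₗ[R] K)
    {F F' : Submodule R M} [Finite (F' ⧸ F.submoduleOf F')] {a b : Ideal R}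
    (hab : a ≤ b) (hb : ∀ β ∈ b, ∃ s ∈ F', algebraMap R K β = φ s)
    (ha : ∀ β, ∀ s ∈ F, algebraMap R K β = φ s → β ∈ a) :
    Ideal.absNorm a ≤ Nat.card (F' ⧸ F.submoduleOf F') * Ideal.absNorm b := by
  rw [Ideal.absNorm_apply, Ideal.absNorm_apply, Submodule.cardQuot_apply, Submodule.cardQuot_apply,
    ← Submodule.card_quotient_mul_card_quotient b a hab]
  refine Nat.mul_le_mul_right _ ?_
  -- Choosing preimages under `φ` gives an injection of sets from `b/a` into `F'/F`; it need not be
  -- additive.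
  have hex : ∀ y : Submodule.map a.mkQ b, ∃ β ∈ b, a.mkQ β = y ∧
      ∃ s ∈ F', algebraMap R K β = φ s := by
    rintro ⟨_, β, hβ, rfl⟩
    exact ⟨β, hβ, rfl, hb β hβ⟩
  choose β hβ hβy s hs hβs using hex
  refine Nat.card_le_card_of_injective
    (fun y ↦ (F.submoduleOf F').mkQ ⟨s y, hs y⟩) fun y z hyz ↦ ?_
  rw [← sub_eq_zero, ← map_sub, Submodule.mkQ_apply, Submodule.Quotient.mk_eq_zero] at hyz
  have hyz' : s y - s z ∈ F := hyz
  have h1 : β y - β z ∈ a := ha _ _ hyz' (by rw [map_sub, map_sub, hβs, hβs])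
  apply Subtype.ext
  rw [← hβy, ← hβy, ← sub_eq_zero, ← map_sub, Submodule.mkQ_apply,
    Submodule.Quotient.mk_eq_zero]
  exact h1

end Arithmetic

/-- Elements of `F'` die in `K ⊗ (M/F)`, so `F'/F` is torsion over `R`. Every nonzero `r` divides a
nonzero integer by integrality, so `F'/F` is a finitely generated torsion abelian group. -/
lemma finite_quotient_of_baseChange_eq {R : Type*} [CommRing R] [IsDomain R] [Module.Finite ℤ R]
    [CharZero R] (K : Type*) [Field K] [Algebra R K] [IsFractionRing R K]
    {M : Type*} [AddCommGroup M] [Module R M] {F F' : Submodule R M} (hF' : F'.FG)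
    (h : F.baseChange K = F'.baseChange K) : Finite (F' ⧸ F.submoduleOf F') := by
  have key : ∀ s ∈ F', ∃ r : R, r ≠ 0 ∧ r • s ∈ F := by
    intro s hs
    have h1 : (1 : K) ⊗ₜ[R] s ∈ F.baseChange K := h ▸ Submodule.tmul_mem_baseChange_of_mem 1 hs
    have h2 : F.baseChange K ≤ LinearMap.ker (F.mkQ.baseChange K) := by
      rw [Submodule.baseChange_eq_span, Submodule.span_le]
      rintro _ ⟨t, ht, rfl⟩
      have : F.mkQ t = 0 := by simpa using ht
      simp [this]
    have h3 : (1 : K) ⊗ₜ[R] F.mkQ s = 0 := h2 h1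
    have : IsLocalizedModule R⁰ (TensorProduct.mk R K (M ⧸ F) 1) :=
      (isLocalizedModule_iff_isBaseChange R⁰ K _).mpr (TensorProduct.isBaseChange _ _ _)
    obtain ⟨r, hr⟩ := (IsLocalizedModule.eq_zero_iff R⁰ (TensorProduct.mk R K (M ⧸ F) 1)).mp h3
    refine ⟨r, nonZeroDivisors.ne_zero r.2, ?_⟩
    rwa [Submonoid.smul_def, ← map_smul, Submodule.mkQ_apply, Submodule.Quotient.mk_eq_zero] at hr
  have : Module.Finite R F' := Module.Finite.iff_fg.mpr hF'
  have : Module.Finite ℤ (F' ⧸ F.submoduleOf F') := Module.Finite.trans R _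
  refine Module.finite_of_fg_torsion _ ?_
  rintro ⟨s, hs⟩
  obtain ⟨r, hr0, hr⟩ := key s hs
  obtain ⟨m, hm, hm0⟩ : ∃ m : ℤ, algebraMap ℤ R m ∈ Ideal.span {r} ∧ m ≠ 0 := by
    have hne : (Ideal.span {r}).comap (algebraMap ℤ R) ≠ ⊥ :=
      Ideal.comap_ne_bot_of_integral_mem hr0 (Ideal.mem_span_singleton_self r)
        (Algebra.IsIntegral.isIntegral r)
    obtain ⟨m, hm, hm0⟩ := Submodule.exists_mem_ne_zero_of_ne_bot hne
    exact ⟨m, hm, hm0⟩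
  refine ⟨⟨m, mem_nonZeroDivisors_of_ne_zero hm0⟩, ?_⟩
  obtain ⟨q, hq⟩ := Ideal.mem_span_singleton'.mp hm
  change m • (F.submoduleOf F').mkQ ⟨s, hs⟩ = 0
  rw [← map_zsmul, Submodule.mkQ_apply, Submodule.Quotient.mk_eq_zero]
  change m • s ∈ F
  rw [← Int.cast_smul_eq_zsmul R, ← eq_intCast (algebraMap ℤ R), ← hq, mul_smul]
  exact F.smul_mem _ hr

end BasePoints

/-! ### Comparison of the multiplicities for different modules -/

noncomputable section

namespace BasePoints

section Comparison
variable {K : Type u} [Field K] [NumberField K] {X : Scheme.{u}}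
  {π : X ⟶ Spec (CommRingCat.of (𝓞 K))} {L : X.Modules}
  {F F' : Submodule (𝓞 K) (pushSections π L)} {P : Spec (CommRingCat.of (𝓞 K)) ⟶ X}

/-- The fractional ideal underlying the image of a finitely generated module. -/
def mapFractional (φ : pushSections π L →ₗ[𝓞 K] K) (hF : F.FG) : FractionalIdeal (𝓞 K)⁰ K :=
  ⟨F.map φ, FractionalIdeal.isFractional_of_fg (hF.map φ)⟩

lemma mem_mapFractional {φ : pushSections π L →ₗ[𝓞 K] K} {hF : F.FG} {z : K} :
    z ∈ mapFractional φ hF ↔ ∃ s ∈ F, φ s = z := Iff.rfl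

lemma mapFractional_ne_zero {φ : pushSections π L →ₗ[𝓞 K] K} (hF : F.FG)
    (h : ∃ s ∈ F, φ s ≠ 0) : mapFractional φ hF ≠ 0 := by
  obtain ⟨s, hs, hs0⟩ := h
  intro h0
  have : φ s ∈ mapFractional φ hF := ⟨s, hs, rfl⟩
  rw [h0, FractionalIdeal.mem_zero_iff] at this
  exact hs0 this

omit [NumberField K] in
lemma GeneratesGenerically.mono (hgen : GeneratesGenerically π L F) (h : F ≤ F') :
    GeneratesGenerically π L F' := by
  intro x hx U hxU t
  obtain ⟨V, i, hxV, hV⟩ := hgen x hx U hxU t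
  exact ⟨V, i, hxV, Submodule.span_mono (Set.image_mono h) hV⟩

omit [NumberField K] in
lemma exists_frame_basicOpen (hL : IsLineBundle L) (P : Spec (CommRingCat.of (𝓞 K)) ⟶ X)
    (x : PrimeSpectrum (𝓞 K)) :
    ∃ (V : X.affineOpens) (e : Γ(L, V)) (h : 𝓞 K), IsFrame L V e ∧ h ∉ x.asIdeal ∧
      (genPt (𝓞 K) ∈ (Spec (CommRingCat.of (𝓞 K))).basicOpen
        ((Scheme.ΓSpecIso (CommRingCat.of (𝓞 K))).inv h)) ∧
      (Spec (CommRingCat.of (𝓞 K))).basicOpen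
        ((Scheme.ΓSpecIso (CommRingCat.of (𝓞 K))).inv h) ≤ P ⁻¹ᵁ V.1 := by
  let y : Spec (CommRingCat.of (𝓞 K)) := x
  obtain ⟨V, e, hxV, -, he⟩ := exists_affine_isFrame hL (U := ⊤) (x := P y) trivial
  obtain ⟨f, hfV, hxf⟩ := (isAffineOpen_top (Spec (CommRingCat.of (𝓞 K)))).exists_basicOpen_le
    (V := P ⁻¹ᵁ V.1) ⟨y, hxV⟩ trivial
  obtain ⟨h, rfl⟩ : ∃ h : 𝓞 K, (Scheme.ΓSpecIso (CommRingCat.of (𝓞 K))).inv h = f :=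
    ⟨(Scheme.ΓSpecIso (CommRingCat.of (𝓞 K))).hom f,
      congr($((Scheme.ΓSpecIso (CommRingCat.of (𝓞 K))).hom_inv_id) f)⟩
  refine ⟨V, e, h, he, ?_, genPt_mem hxf, hfV⟩
  have := hxf
  rw [basicOpen_eq_of_affine] at this
  exact this

omit [NumberField K] in
lemma algebraMap_pow_ne_zero {v : PrimeSpectrum (𝓞 K)} {h : 𝓞 K} (hv : h ∉ v.asIdeal) (n : ℕ) :
    algebraMap (𝓞 K) K (h ^ n) ≠ 0 := by
  rw [Ne, FaithfulSMul.algebraMap_eq_zero_iff]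
  refine pow_ne_zero _ ?_
  rintro rfl
  exact hv (zero_mem _)

lemma pullbackIdeal_ne_bot [IsIntegral X] (hL : IsLineBundle L) (hP : P ≫ π = 𝟙 _)
    (hgen : GeneratesGenerically π L F) : pullbackIdeal π L F P ≠ ⊥ := by
  obtain ⟨V, e, h, he, hv, hD, hle⟩ := exists_frame_basicOpen hL P ⊥
  obtain ⟨s, hs, hs0⟩ := exists_eval_ne_zero hgen he hP (hle hD)
  obtain ⟨n, x, hx, hxs⟩ := (he.exists_pow_smul_eval (F := F) hL V hP h hD hle).2 s hs
  intro hbot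
  rw [hbot, Ideal.mem_bot] at hx
  rw [hx, map_zero] at hxs
  exact mul_ne_zero (algebraMap_pow_ne_zero hv n) hs0 hxs

/-- The constant is the valuation of the factor between the fixed frame and a frame around `P v`. It
is quantified before `F`, so it cancels in comparisons. -/
lemma count_pullbackIdeal [IsIntegral X] (hL : IsLineBundle L) (hP : P ≫ π = 𝟙 _)
    {V₀ : X.Opens} {e₀ : Γ(L, V₀)} (he₀ : IsFrame L V₀ e₀) (hV₀ : P (genPt (𝓞 K)) ∈ V₀)
    (v : HeightOneSpectrum (𝓞 K)) :
    ∃ c : ℤ, ∀ (F : Submodule (𝓞 K) (pushSections π L)) (hF : F.FG),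
      GeneratesGenerically π L F →
        beta π L F P v = c + FractionalIdeal.count K v (mapFractional (he₀.eval hP hV₀) hF) := by
  obtain ⟨V, e, h, he, hv, hD, hle⟩ := exists_frame_basicOpen hL P ⟨v.asIdeal, v.isPrime⟩
  obtain ⟨u, hu, hφ⟩ := he₀.exists_eval_eq_mul he hP hV₀ (hle hD)
  refine ⟨FractionalIdeal.count K v (FractionalIdeal.spanSingleton (𝓞 K)⁰ u), fun F hF hgen ↦ ?_⟩
  obtain ⟨h1, h2⟩ := he.exists_pow_smul_eval (F := F) hL V hP h hD hle
  have hI' : (pullbackIdeal π L F P : FractionalIdeal (𝓞 K)⁰ K) ≠ 0 := by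
    simpa using pullbackIdeal_ne_bot hL hP hgen
  have hN := mapFractional_ne_zero hF (exists_eval_ne_zero hgen he hP (hle hD))
  have hN₀ := mapFractional_ne_zero hF (exists_eval_ne_zero hgen he₀ hP hV₀)
  have hu' : FractionalIdeal.spanSingleton (𝓞 K)⁰ u ≠ 0 :=
    FractionalIdeal.spanSingleton_ne_zero_iff.mpr hu
  have heq : mapFractional (he.eval hP (hle hD)) hF =
      FractionalIdeal.spanSingleton (𝓞 K)⁰ u * mapFractional (he₀.eval hP hV₀) hF := by
    ext z
    rw [mem_mapFractional, FractionalIdeal.mem_singleton_mul]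
    constructor
    · rintro ⟨s, hs, rfl⟩
      exact ⟨_, ⟨s, hs, rfl⟩, hφ s⟩
    · rintro ⟨_, ⟨s, hs, rfl⟩, rfl⟩
      exact ⟨s, hs, hφ s⟩
  rw [← FractionalIdeal.count_mul K v hu' hN₀, ← heq, beta]
  apply le_antisymm
  · refine count_le_count_of_locally v hv hN ?_
    rintro _ ⟨s, hs, rfl⟩
    obtain ⟨n, x, hx, hxs⟩ := h2 s hs
    exact ⟨n, hxs ▸ FractionalIdeal.mem_coeIdeal_of_mem _ hx⟩
  · refine count_le_count_of_locally v hv hI' ?_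
    intro z hz
    obtain ⟨x, hx, rfl⟩ := (FractionalIdeal.mem_coeIdeal _).mp hz
    obtain ⟨n, s, hs, h⟩ := h1 x hx
    exact ⟨n, s, hs, by rw [← h, map_mul]⟩

/-- A denominator `d` of `φ(F')` also clears `φ(F)`. Scaling both by `d` gives integral ideals
without changing the difference of valuations. -/
lemma exists_integral_ideals (φ : pushSections π L →ₗ[𝓞 K] K) (hF : F.FG) (hF' : F'.FG)
    (hFF' : F ≤ F') (h0 : ∃ s ∈ F, φ s ≠ 0) :
    ∃ (a b : Ideal (𝓞 K)), a ≠ ⊥ ∧ b ≠ ⊥ ∧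
      (∀ v, FractionalIdeal.count K v (mapFractional φ hF) -
          FractionalIdeal.count K v (mapFractional φ hF') =
        FractionalIdeal.count K v (a : FractionalIdeal (𝓞 K)⁰ K) -
          FractionalIdeal.count K v (b : FractionalIdeal (𝓞 K)⁰ K)) ∧
      (Finite (F' ⧸ F.submoduleOf F') →
        Ideal.absNorm a ≤ Nat.card (F' ⧸ F.submoduleOf F') * Ideal.absNorm b) := by
  have hN := mapFractional_ne_zero hF h0
  have hN' := mapFractional_ne_zero hF' (h0.imp fun s hs ↦ ⟨hFF' hs.1, hs.2⟩)
  obtain ⟨d, b, hd, hb⟩ := FractionalIdeal.exists_eq_spanSingleton_mul (mapFractional φ hF')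
  have hd' : algebraMap (𝓞 K) K d ≠ 0 := by simpa using hd
  have hD : FractionalIdeal.spanSingleton (𝓞 K)⁰ (algebraMap (𝓞 K) K d) ≠ 0 :=
    FractionalIdeal.spanSingleton_ne_zero_iff.mpr hd'
  have hb' : FractionalIdeal.spanSingleton (𝓞 K)⁰ (algebraMap (𝓞 K) K d) * mapFractional φ hF' =
      b := by
    rw [hb, ← mul_assoc, FractionalIdeal.spanSingleton_mul_spanSingleton, mul_inv_cancel₀ hd',
      FractionalIdeal.spanSingleton_one, one_mul]
  have hle : FractionalIdeal.spanSingleton (𝓞 K)⁰ (algebraMap (𝓞 K) K d) * mapFractional φ hF ≤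
      b := by
    rw [← hb']
    refine mul_le_mul_right (show mapFractional φ hF ≤ mapFractional φ hF' from
      Submodule.map_mono hFF') _
  obtain ⟨a, ha⟩ := FractionalIdeal.le_one_iff_exists_coeIdeal.mp
    (hle.trans FractionalIdeal.coeIdeal_le_one)
  have hab : a ≤ b := by rwa [← ha, FractionalIdeal.coeIdeal_le_coeIdeal] at hle
  refine ⟨a, b, ?_, ?_, fun v ↦ ?_, fun _ ↦ ?_⟩
  · rintro rfl
    exact mul_ne_zero hD hN (by simpa using ha.symm)
  · rintro rfl
    exact mul_ne_zero hD hN' (by simpa using hb')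
  · rw [ha, ← hb', FractionalIdeal.count_mul K v hD hN, FractionalIdeal.count_mul K v hD hN']
    ring
  · refine absNorm_le_mul_card (d • φ) hab (fun β hβ ↦ ?_) fun β s hs h ↦ ?_
    · have h1 := FractionalIdeal.mem_coeIdeal_of_mem (𝓞 K)⁰ (P := K) hβ
      rw [← hb', FractionalIdeal.mem_singleton_mul] at h1
      obtain ⟨_, ⟨s, hs, rfl⟩, h1⟩ := h1
      exact ⟨s, hs, by rw [h1, LinearMap.smul_apply, Algebra.smul_def]⟩
    · have h1 : algebraMap (𝓞 K) K β ∈ (a : FractionalIdeal (𝓞 K)⁰ K) := by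
        rw [ha, FractionalIdeal.mem_singleton_mul]
        exact ⟨_, ⟨s, hs, rfl⟩, by rw [h, LinearMap.smul_apply, Algebra.smul_def]⟩
      obtain ⟨x, hx, hxβ⟩ := (FractionalIdeal.mem_coeIdeal _).mp h1
      rwa [← FaithfulSMul.algebraMap_injective (𝓞 K) K hxβ]

end Comparison
end BasePoints
end

theorem mainTheorem9 {K : Type u} [Field K] [NumberField K] {X : Scheme.{u}}
    (π : X ⟶ Spec (CommRingCat.of (𝓞 K))) [AlgebraicGeometry.IsIntegral X] [Flat π]
    (hqp : BasePoints.IsQuasiProjective π) [Smooth (BasePoints.genericFibre π)]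
    (L : X.Modules) (hL : BasePoints.IsLineBundle L)
    (F F' : Submodule (𝓞 K) (BasePoints.pushSections π L))
    (hF : F.FG) (hF' : F'.FG) (hFF' : F ≤ F')
    (hgen : BasePoints.GeneratesGenerically π L F)
    (P : Spec (CommRingCat.of (𝓞 K)) ⟶ X) (hP : P ≫ π = 𝟙 _) :
    (BasePoints.pullbackIdeal π L F P ≠ ⊥ ∧ BasePoints.pullbackIdeal π L F' P ≠ ⊥ ∧
      {𝔭 : HeightOneSpectrum (𝓞 K) | BasePoints.beta π L F P 𝔭 ≠ 0}.Finite ∧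
      {𝔭 : HeightOneSpectrum (𝓞 K) | BasePoints.beta π L F' P 𝔭 ≠ 0}.Finite) ∧
    (∀ 𝔭 : HeightOneSpectrum (𝓞 K),
      0 ≤ BasePoints.beta π L F' P 𝔭 ∧
        BasePoints.beta π L F' P 𝔭 ≤ BasePoints.beta π L F P 𝔭) ∧
    (F.baseChange K = F'.baseChange K →
      Finite (F' ⧸ F.submoduleOf F') ∧
      (∑ᶠ 𝔭 : HeightOneSpectrum (𝓞 K),
          (BasePoints.beta π L F P 𝔭 : ℝ) * Real.log (Ideal.absNorm 𝔭.asIdeal)) -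
        (∑ᶠ 𝔭 : HeightOneSpectrum (𝓞 K),
          (BasePoints.beta π L F' P 𝔭 : ℝ) * Real.log (Ideal.absNorm 𝔭.asIdeal)) ≤
        Real.log (Nat.card (F' ⧸ F.submoduleOf F'))) := by
  have hgen' := hgen.mono hFF'
  -- The reference frame, shared by all primes and by both modules, is taken around the image of the
  -- generic point.
  obtain ⟨V₀, e₀, h₀, he₀, -, hD₀, hle₀⟩ := BasePoints.exists_frame_basicOpen hL P ⊥
  have hV₀ : P (BasePoints.genPt (𝓞 K)) ∈ V₀.1 := hle₀ hD₀
  choose c hc using BasePoints.count_pullbackIdeal hL hP he₀ hV₀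
  have hfin : ∀ G : Submodule (𝓞 K) (BasePoints.pushSections π L),
      {𝔭 : HeightOneSpectrum (𝓞 K) | BasePoints.beta π L G P 𝔭 ≠ 0}.Finite := fun G ↦
    Filter.eventually_cofinite.mp (FractionalIdeal.finite_factors (K := K) _)
  refine ⟨⟨BasePoints.pullbackIdeal_ne_bot hL hP hgen, BasePoints.pullbackIdeal_ne_bot hL hP hgen',
    hfin F, hfin F'⟩, fun v ↦ ⟨?_, ?_⟩, fun hK ↦ ?_⟩
  · exact FractionalIdeal.count_coe_nonneg K v _
  · rw [hc v F hF hgen, hc v F' hF' hgen']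
    gcongr
    exact FractionalIdeal.count_mono K v
      (BasePoints.mapFractional_ne_zero hF (BasePoints.exists_eval_ne_zero hgen he₀ hP hV₀))
      (Submodule.map_mono hFF')
  · have hfinite := BasePoints.finite_quotient_of_baseChange_eq K hF' hK
    refine ⟨hfinite, ?_⟩
    obtain ⟨a, b, ha, hb, hcount, hcard⟩ := BasePoints.exists_integral_ideals
      (he₀.eval hP hV₀) hF hF' hFF' (BasePoints.exists_eval_ne_zero hgen he₀ hP hV₀)
    have hsupp : ∀ I : FractionalIdeal (𝓞 K)⁰ K, (Function.support
        fun v : HeightOneSpectrum (𝓞 K) ↦ (FractionalIdeal.count K v I : ℝ) *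
          Real.log (Ideal.absNorm v.asIdeal)).Finite := by
      intro I
      refine (Filter.eventually_cofinite.mp (FractionalIdeal.finite_factors (K := K) I)).subset ?_
      intro v hv h0
      simp [h0] at hv
    have hsupp' : ∀ G : Submodule (𝓞 K) (BasePoints.pushSections π L), (Function.support
        fun v : HeightOneSpectrum (𝓞 K) ↦ (BasePoints.beta π L G P v : ℝ) *
          Real.log (Ideal.absNorm v.asIdeal)).Finite := fun G ↦ hsupp _
    have hsum : (∑ᶠ v : HeightOneSpectrum (𝓞 K),
          (BasePoints.beta π L F P v : ℝ) * Real.log (Ideal.absNorm v.asIdeal)) -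
        (∑ᶠ v : HeightOneSpectrum (𝓞 K),
          (BasePoints.beta π L F' P v : ℝ) * Real.log (Ideal.absNorm v.asIdeal)) =
        Real.log (Ideal.absNorm a) - Real.log (Ideal.absNorm b) := by
      rw [BasePoints.log_absNorm_eq_finsum (K := K) a ha,
        BasePoints.log_absNorm_eq_finsum (K := K) b hb,
        ← finsum_sub_distrib (hsupp' F) (hsupp' F'), ← finsum_sub_distrib (hsupp _) (hsupp _)]
      refine finsum_congr fun v ↦ ?_
      -- The frame-dependent constants `c v` cancel here, prime by prime.
      rw [← sub_mul, ← sub_mul, ← Int.cast_sub, ← Int.cast_sub, ← hcount,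
        hc v F hF hgen, hc v F' hF' hgen', add_sub_add_left_eq_sub]
    have hb0 : (Ideal.absNorm b : ℝ) ≠ 0 := by
      rwa [Nat.cast_ne_zero, Ne, Ideal.absNorm_eq_zero_iff]
    have ha0 : Ideal.absNorm a ≠ 0 := by rwa [Ne, Ideal.absNorm_eq_zero_iff]
    have hcard0 : (Nat.card (F' ⧸ F.submoduleOf F') : ℝ) ≠ 0 :=
      Nat.cast_ne_zero.mpr Nat.card_pos.ne'
    rw [hsum, sub_le_iff_le_add, ← Real.log_mul hcard0 hb0]
    refine Real.log_le_log (by exact_mod_cast Nat.pos_of_ne_zero ha0) ?_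
    exact_mod_cast hcard hfinite
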